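/- Let $d\ge 1$ and let $\omega:[0,\infty)\to[0,\infty)$ be a non-quasianalytic weight function in the sense of Braun, Meise and Taylor, i.e. $\omega$ is continuous and increasing (not necessarily strictly) and satisfies: $(\alpha)$ there is $L\ge 1$ with $\omega(2t)\le L\omega(t)+L$ for all $t\ge 0$; $(\beta)$ $\int_1^\infty \frac{\omega(t)}{1+t^2}\,dt<\infty$; $(\gamma)$ $\log t=O(\omega(t))$ as $t\to\infty$; $(\delta)$ $t\mapsto\omega(e^t)$ is convex on $\mathbb{R}$. Write $\omega(x)=\omega(|x|)$ for $x\in\mathbb{R}^d$ and $\widehat f(\xi)=\int_{\mathbb{R}^d}e^{-it\cdot\xi}f(t)\,dt$. Let $\mathcal{S}_\omega(\mathbb{R}^d)$ be the space of all $f\in L^1(\mathbb{R}^d)$ with $f,\widehat f\in C^\infty(\mathbb{R}^d)$ such that, for all $\lambda>0$ and $\alpha\in\mathbb{N}_0^d$, $$\sup_{x\in\mathbb{R}^d}|D^\alpha f(x)|e^{\lambda\omega(x)}<\infty\quad\text{and}\quad \sup_{\xi\in\mathbb{R}^d}|D^\alpha\widehat f(\xi)|e^{\lambda\omega(\xi)}<\infty,$$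 with the locally convex topology given by these seminorms, and let $\mathcal{S}'_\omega(\mathbb{R}^d)$ be its dual, the space of continuous conjugate-linear functionals $a:f\mapsto\langle a,f\rangle$ on $\mathcal{S}_\omega(\mathbb{R}^d)$. For $a\in\mathcal{S}'_\omega(\mathbb{R}^d)$ and $f\in\mathcal{S}_\omega(\mathbb{R}^d)$ put $(a\ast f)(x)=\langle a,\overline{f(x-\cdot)}\rangle$, $x\in\mathbb{R}^d$. An $\omega$-convolutor is an $a\in\mathcal{S}'_\omega(\mathbb{R}^d)$ such that $a\ast f\in\mathcal{S}_\omega(\mathbb{R}^d)$ for every $f\in\mathcal{S}_\omega(\mathbb{R}^d)$. A linear operator $T:E\to F$ between Hausdorff locally convex spaces is compact if there is a $0$-neighbourhood $U$ in $E$ such that $T(U)$ is relatively compact in $F$. **Theorem.** Let $a$ be an $\omega$-convolutor. Then the convolution operator $\mathcal{C}_a:\mathcal{S}_\omega(\mathbb{R}^d)\to\mathcal{S}_\omega(\mathbb{R}^d)$, $f\mapsto a\ast f$, is compact if and only if $a=0$. -/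

import Mathlib

noncomputable section

namespace OmegaConv

open MeasureTheory Filter Topology Set
open scoped ContDiff ComplexConjugate

/-- Non-quasianalytic weight functions in the sense of Braun, Meise and Taylor. Only the values on
`[0, ∞)` matter. "Increasing" is understood in the weak sense. -/
structure Weight where
  /-- the underlying function -/
  toFun : ℝ → ℝ
  nonneg : ∀ t, 0 ≤ t → 0 ≤ toFun t
  monotoneOn : MonotoneOn toFun (Ici 0)
  continuousOn : ContinuousOn toFun (Ici 0)
  alpha : ∃ L : ℝ, 1 ≤ L ∧ ∀ t, 0 ≤ t → toFun (2 * t) ≤ L * toFun t + L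
  beta : IntegrableOn (fun t => toFun t / (1 + t ^ 2)) (Ioi 1)
  gamma : Real.log =O[atTop] toFun
  delta : ConvexOn ℝ univ (fun t => toFun (Real.exp t))

instance : CoeFun Weight (fun _ => ℝ → ℝ) := ⟨Weight.toFun⟩

/-- `ℝ^d` with its Euclidean norm. -/
abbrev E (d : ℕ) := EuclideanSpace ℝ (Fin d)

/-- The Fourier transform `f̂(ξ) = ∫ e^{-i t·ξ} f(t) dt`. -/
def fourier {d : ℕ} (f : E d → ℂ) (ξ : E d) : ℂ :=
  ∫ t, Complex.exp (-(Complex.I * (inner ℝ t ξ : ℝ))) * f t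

/-- `‖D^n g(x)‖ e^{l w(|x|)}`, where `D^n g` is the full `n`-th derivative; its norm is comparable
to the maximum of `|D^α g(x)|` over the multi-indices with `|α| = n`. -/
def wt {d : ℕ} (w : Weight) (l : ℝ) (n : ℕ) (g : E d → ℂ) (x : E d) : ℝ :=
  ‖iteratedFDeriv ℝ n g x‖ * Real.exp (l * w ‖x‖)

/-- `g` is smooth and `sup_x |D^α g(x)| e^{l w(x)} < ∞` for all `l > 0` and all `α`. -/
structure Decays {d : ℕ} (w : Weight) (g : E d → ℂ) : Prop where
  smooth : ContDiff ℝ ∞ g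
  bdd : ∀ l : ℝ, 0 < l → ∀ n : ℕ, BddAbove (range (wt w l n g))

/-- Membership in `S_w(ℝ^d)`. -/
structure MemSOmega {d : ℕ} (w : Weight) (f : E d → ℂ) : Prop where
  integrable : Integrable f
  decays : Decays w f
  decays_fourier : Decays w (fourier f)

section closure

variable {d : ℕ} {w : Weight}

theorem wt_nonneg (l : ℝ) (n : ℕ) (g : E d → ℂ) (x : E d) : 0 ≤ wt w l n g x := by
  unfold wt; positivity

theorem wt_zero (l : ℝ) (n : ℕ) (x : E d) : wt w l n (0 : E d → ℂ) x = 0 := by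
  simp [wt]

theorem wt_add_le {l : ℝ} {n : ℕ} {f g : E d → ℂ} (hf : ContDiff ℝ ∞ f) (hg : ContDiff ℝ ∞ g)
    (x : E d) : wt w l n (f + g) x ≤ wt w l n f x + wt w l n g x := by
  unfold wt
  rw [iteratedFDeriv_add_apply (hf.of_le (mod_cast le_top)).contDiffAt
    (hg.of_le (mod_cast le_top)).contDiffAt, ← add_mul]
  gcongr
  exact norm_add_le _ _

theorem wt_smul {l : ℝ} {n : ℕ} {f : E d → ℂ} (hf : ContDiff ℝ ∞ f) (c : ℂ)
    (x : E d) : wt w l n (c • f) x = ‖c‖ * wt w l n f x := by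
  unfold wt
  rw [iteratedFDeriv_const_smul_apply (hf.of_le (mod_cast le_top)).contDiffAt, norm_smul, mul_assoc]

theorem Decays.zero : Decays w (0 : E d → ℂ) :=
  ⟨contDiff_const, fun l _ n => ⟨0, by rintro _ ⟨x, rfl⟩; exact (wt_zero l n x).le⟩⟩

theorem Decays.add {f g : E d → ℂ} (hf : Decays w f) (hg : Decays w g) : Decays w (f + g) := by
  refine ⟨hf.smooth.add hg.smooth, fun l hl n => ?_⟩
  obtain ⟨A, hA⟩ := hf.bdd l hl n
  obtain ⟨B, hB⟩ := hg.bdd l hl n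
  refine ⟨A + B, ?_⟩
  rintro _ ⟨x, rfl⟩
  exact (wt_add_le hf.smooth hg.smooth x).trans (add_le_add (hA ⟨x, rfl⟩) (hB ⟨x, rfl⟩))

theorem Decays.smul {f : E d → ℂ} (c : ℂ) (hf : Decays w f) : Decays w (c • f) := by
  refine ⟨contDiff_const.smul hf.smooth, fun l hl n => ?_⟩
  obtain ⟨A, hA⟩ := hf.bdd l hl n
  refine ⟨‖c‖ * A, ?_⟩
  rintro _ ⟨x, rfl⟩
  rw [wt_smul hf.smooth]
  exact mul_le_mul_of_nonneg_left (hA ⟨x, rfl⟩) (norm_nonneg _)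

theorem integrable_char_mul {f : E d → ℂ} (hf : Integrable f) (ξ : E d) :
    Integrable (fun t => Complex.exp (-(Complex.I * (inner ℝ t ξ : ℝ))) * f t) := by
  refine hf.bdd_mul (c := 1) (Continuous.aestronglyMeasurable (by fun_prop)) ?_
  refine Eventually.of_forall fun t => ?_
  rw [Complex.norm_exp]
  simp

theorem fourier_zero : fourier (0 : E d → ℂ) = 0 := by
  ext ξ; simp [fourier]

theorem fourier_add {f g : E d → ℂ} (hf : Integrable f) (hg : Integrable g) :
    fourier (f + g) = fourier f + fourier g := by
  ext ξ
  simp only [fourier, Pi.add_apply, mul_add]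
  exact integral_add (integrable_char_mul hf ξ) (integrable_char_mul hg ξ)

theorem fourier_smul (c : ℂ) (f : E d → ℂ) : fourier (c • f) = c • fourier f := by
  ext ξ
  simp only [fourier, Pi.smul_apply, smul_eq_mul, mul_left_comm _ c]
  exact integral_const_mul _ _

end closure

/-- `S_w(ℝ^d)` as a subspace of the space of all functions. -/
def sOmegaSubmodule (d : ℕ) (w : Weight) : Submodule ℂ (E d → ℂ) where
  carrier := {f | MemSOmega w f}
  zero_mem' := ⟨integrable_zero _ _ _, Decays.zero, by rw [fourier_zero]; exact Decays.zero⟩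
  add_mem' {f g} hf hg := ⟨hf.integrable.add hg.integrable, hf.decays.add hg.decays, by
    rw [fourier_add hf.integrable hg.integrable]; exact hf.decays_fourier.add hg.decays_fourier⟩
  smul_mem' c f hf := ⟨hf.integrable.smul c, hf.decays.smul c, by
    rw [fourier_smul]; exact hf.decays_fourier.smul c⟩

/-- The space `S_w(ℝ^d)`. It is a type of its own, so that it does not inherit the topology of
pointwise convergence. -/
def SOmega (d : ℕ) (w : Weight) : Type := ↥(sOmegaSubmodule d w)

namespace SOmega

variable {d : ℕ} {w : Weight}

instance : AddCommGroup (SOmega d w) := inferInstanceAs (AddCommGroup ↥(sOmegaSubmodule d w))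

instance : Module ℂ (SOmega d w) := inferInstanceAs (Module ℂ ↥(sOmegaSubmodule d w))

/-- The underlying function. -/
def val (f : SOmega d w) : E d → ℂ := Subtype.val f

/-- An element of `S_w(ℝ^d)` from a function and a proof of membership. -/
def mk (f : E d → ℂ) (hf : MemSOmega w f) : SOmega d w := ⟨f, hf⟩

theorem mem (f : SOmega d w) : MemSOmega w f.val := Subtype.property f

@[ext] theorem ext {f g : SOmega d w} (h : ∀ x, f.val x = g.val x) : f = g :=
  Subtype.ext (funext h)

@[simp] theorem val_mk (f : E d → ℂ) (hf : MemSOmega w f) : (mk f hf).val = f := rfl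
@[simp] theorem val_zero : (0 : SOmega d w).val = 0 := rfl
@[simp] theorem val_add (f g : SOmega d w) : (f + g).val = f.val + g.val := rfl
@[simp] theorem val_smul (c : ℂ) (f : SOmega d w) : (c • f).val = c • f.val := rfl

/-- The seminorm `f ↦ sup_x ‖D^n f(x)‖ e^{l w(x)}`. -/
def seminorm (l : {l : ℝ // 0 < l}) (n : ℕ) : Seminorm ℂ (SOmega d w) :=
  Seminorm.ofSMulLE (fun f => ⨆ x, wt w l n f.val x)
    (by simp [wt_zero])
    (fun f g => ciSup_le fun x =>
      (wt_add_le f.mem.decays.smooth g.mem.decays.smooth x).trans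
        (add_le_add (le_ciSup (f.mem.decays.bdd l l.2 n) x)
          (le_ciSup (g.mem.decays.bdd l l.2 n) x)))
    (fun c f => ciSup_le fun x => by
      rw [val_smul, wt_smul f.mem.decays.smooth]
      exact mul_le_mul_of_nonneg_left (le_ciSup (f.mem.decays.bdd l l.2 n) x) (norm_nonneg _))

/-- The seminorm `f ↦ sup_ξ ‖D^n f̂(ξ)‖ e^{l w(ξ)}`. -/
def seminormFourier (l : {l : ℝ // 0 < l}) (n : ℕ) : Seminorm ℂ (SOmega d w) :=
  Seminorm.ofSMulLE (fun f => ⨆ x, wt w l n (fourier f.val) x)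
    (by simp [fourier_zero, wt_zero])
    (fun f g => ciSup_le fun x => by
      rw [val_add, fourier_add f.mem.integrable g.mem.integrable]
      exact (wt_add_le f.mem.decays_fourier.smooth g.mem.decays_fourier.smooth x).trans
        (add_le_add (le_ciSup (f.mem.decays_fourier.bdd l l.2 n) x)
          (le_ciSup (g.mem.decays_fourier.bdd l l.2 n) x)))
    (fun c f => ciSup_le fun x => by
      rw [val_smul, fourier_smul, wt_smul f.mem.decays_fourier.smooth]
      exact mul_le_mul_of_nonneg_left (le_ciSup (f.mem.decays_fourier.bdd l l.2 n) x)
        (norm_nonneg _))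

/-- The seminorms that define the topology of `S_w(ℝ^d)`. -/
def seminormFamily (d : ℕ) (w : Weight) :
    SeminormFamily ℂ (SOmega d w) (({l : ℝ // 0 < l} × ℕ) ⊕ ({l : ℝ // 0 < l} × ℕ)) :=
  Sum.elim (fun p => seminorm p.1 p.2) (fun p => seminormFourier p.1 p.2)

instance : Nonempty {l : ℝ // 0 < l} := ⟨⟨1, one_pos⟩⟩

instance : TopologicalSpace (SOmega d w) := (seminormFamily d w).moduleFilterBasis.topology

theorem withSeminorms (d : ℕ) (w : Weight) : WithSeminorms (seminormFamily d w) := ⟨rfl⟩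

end SOmega

/-- The dual space `S'_w(ℝ^d)`: continuous conjugate-linear functionals, so that the bracket
`⟨a, f⟩ = a f` is consistent with the inner product `∫ a(y) conj (f y) dy` of `L²`. -/
abbrev DualSOmega (d : ℕ) (w : Weight) := SOmega d w →SL[starRingEnd ℂ] ℂ

/-- The function `y ↦ conj (f (x - y))`. -/
def conjReflTrans {d : ℕ} (x : E d) (f : E d → ℂ) (y : E d) : ℂ := conj (f (x - y))

section translation

variable {d : ℕ} {w : Weight}

/-- A substitute for subadditivity, which follows from `(α)`. -/
theorem Weight.exists_add_le (w : Weight) : ∃ L : ℝ, 1 ≤ L ∧ ∀ s t, 0 ≤ s → 0 ≤ t →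
    w (s + t) ≤ L * w s + L * w t + L := by
  obtain ⟨L, hL, h⟩ := w.alpha
  refine ⟨L, hL, fun s t hs ht => ?_⟩
  have hm : 0 ≤ max s t := le_max_of_le_left hs
  have h1 : w (s + t) ≤ w (2 * max s t) := w.monotoneOn (mem_Ici.2 (by positivity))
    (mem_Ici.2 (by positivity)) (by linarith [le_max_left s t, le_max_right s t])
  have h2 := h _ hm
  have h3 : w (max s t) ≤ w s + w t := by
    rcases max_cases s t with ⟨e, _⟩ | ⟨e, _⟩ <;> rw [e]
    · linarith [w.nonneg t ht]
    · linarith [w.nonneg s hs]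
  nlinarith

theorem norm_iteratedFDeriv_conjReflTrans (x : E d) (f : E d → ℂ) (n : ℕ)
    (y : E d) : ‖iteratedFDeriv ℝ n (conjReflTrans x f) y‖ = ‖iteratedFDeriv ℝ n f (x - y)‖ := by
  have e : conjReflTrans x f = fun y => (Complex.conjLIE ∘ (f ∘ LinearIsometryEquiv.neg ℝ)) (y - x) := by
    ext y; simp [conjReflTrans]
  rw [e, iteratedFDeriv_comp_sub, LinearIsometryEquiv.norm_iteratedFDeriv_comp_left,
    LinearIsometryEquiv.norm_iteratedFDeriv_comp_right]
  simp

theorem Decays.conjReflTrans {f : E d → ℂ} (hf : Decays w f) (x : E d) :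
    Decays w (conjReflTrans x f) := by
  refine ⟨?_, fun l hl n => ?_⟩
  · exact Complex.conjCLE.contDiff.comp (hf.smooth.comp (contDiff_const.sub contDiff_id))
  · obtain ⟨L, hL, hsub⟩ := w.exists_add_le
    obtain ⟨A, hA⟩ := hf.bdd (l * L) (by positivity) n
    refine ⟨A * Real.exp (l * (L * w ‖x‖ + L)), ?_⟩
    rintro _ ⟨y, rfl⟩
    have h1 : w ‖y‖ ≤ L * w ‖x - y‖ + L * w ‖x‖ + L := by
      refine le_trans (w.monotoneOn (mem_Ici.2 (norm_nonneg _)) (mem_Ici.2 (by positivity)) ?_)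
        (hsub ‖x - y‖ ‖x‖ (norm_nonneg _) (norm_nonneg _))
      calc ‖y‖ = ‖x - (x - y)‖ := by simp
        _ ≤ ‖x‖ + ‖x - y‖ := norm_sub_le _ _
        _ = _ := add_comm _ _
    have h2 : wt w (l * L) n f (x - y) ≤ A := hA ⟨x - y, rfl⟩
    unfold wt at h2 ⊢
    rw [norm_iteratedFDeriv_conjReflTrans]
    calc _ ≤ ‖iteratedFDeriv ℝ n f (x - y)‖ *
          (Real.exp (l * L * w ‖x - y‖) * Real.exp (l * (L * w ‖x‖ + L))) := by
          rw [← Real.exp_add]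
          gcongr
          nlinarith
      _ = (‖iteratedFDeriv ℝ n f (x - y)‖ * Real.exp (l * L * w ‖x - y‖)) *
          Real.exp (l * (L * w ‖x‖ + L)) := by ring
      _ ≤ _ := by gcongr

theorem fourier_conjReflTrans (x : E d) (f : E d → ℂ) (ξ : E d) :
    fourier (conjReflTrans x f) ξ =
      Complex.exp (-(Complex.I * (inner ℝ x ξ : ℝ))) * conj (fourier f ξ) := by
  unfold fourier
  rw [← integral_conj, ← integral_const_mul,
    ← integral_sub_left_eq_self (fun u => Complex.exp (-(Complex.I * (inner ℝ x ξ : ℝ))) *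
      conj (Complex.exp (-(Complex.I * (inner ℝ u ξ : ℝ))) * f u)) volume x]
  congr 1
  ext y
  simp only [conjReflTrans, map_mul, ← mul_assoc, ← Complex.exp_conj, ← Complex.exp_add]
  congr 2
  simp [inner_sub_left]
  ring

theorem contDiff_char (x : E d) :
    ContDiff ℝ ∞ (fun ξ : E d => Complex.exp (-(Complex.I * (inner ℝ x ξ : ℝ)))) := by
  have h : ContDiff ℝ ∞ (fun ξ : E d => (inner ℝ x ξ : ℝ)) := (innerSL ℝ x).contDiff
  exact ((contDiff_const.mul (Complex.ofRealCLM.contDiff.comp h)).neg).cexp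

theorem norm_iteratedFDeriv_char_le (x : E d) (n : ℕ) (ξ : E d) :
    ‖iteratedFDeriv ℝ n (fun ξ : E d => Complex.exp (-(Complex.I * (inner ℝ x ξ : ℝ)))) ξ‖
      ≤ ‖x‖ ^ n := by
  have key : ∀ n : ℕ, iteratedDeriv n (fun s : ℝ => Complex.exp (-(Complex.I * (s : ℂ)))) =
      fun s : ℝ => (-Complex.I) ^ n * Complex.exp (-(Complex.I * (s : ℂ))) := by
    intro n
    induction n with
    | zero => simp
    | succ k ih =>
      rw [iteratedDeriv_succ, ih]
      ext s
      have h1 : HasDerivAt (fun s : ℝ => -(Complex.I * (s : ℂ))) (-(Complex.I * 1)) s :=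
        ((Complex.ofRealCLM.hasDerivAt (x := s)).const_mul Complex.I).neg
      rw [(h1.cexp.const_mul ((-Complex.I) ^ k)).deriv]
      ring
  have hsm : ContDiff ℝ ∞ (fun s : ℝ => Complex.exp (-(Complex.I * (s : ℂ)))) :=
    ((contDiff_const.mul Complex.ofRealCLM.contDiff).neg).cexp
  have e : (fun ξ : E d => Complex.exp (-(Complex.I * (inner ℝ x ξ : ℝ)))) =
      (fun s : ℝ => Complex.exp (-(Complex.I * (s : ℂ)))) ∘ (innerSL ℝ x) := by
    ext ξ; simp
  rw [e, (innerSL ℝ x).iteratedFDeriv_comp_right hsm ξ (i := n) (mod_cast le_top)]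
  refine (ContinuousMultilinearMap.norm_compContinuousLinearMap_le _ _).trans ?_
  rw [norm_iteratedFDeriv_eq_norm_iteratedDeriv, key]
  simp [Complex.norm_exp]

theorem Decays.char_mul {g : E d → ℂ} (hg : Decays w g) (x : E d) :
    Decays w (fun ξ => Complex.exp (-(Complex.I * (inner ℝ x ξ : ℝ))) * g ξ) := by
  refine ⟨(contDiff_char x).mul hg.smooth, fun l hl n => ?_⟩
  choose A hA using fun k => hg.bdd l hl k
  refine ⟨∑ i ∈ Finset.range (n + 1), (n.choose i : ℝ) * ‖x‖ ^ i * A (n - i), ?_⟩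
  rintro _ ⟨ξ, rfl⟩
  unfold wt
  refine (mul_le_mul_of_nonneg_right (norm_iteratedFDeriv_mul_le (contDiff_char x) hg.smooth ξ
    (n := n) (mod_cast le_top)) (Real.exp_nonneg _)).trans ?_
  rw [Finset.sum_mul]
  refine Finset.sum_le_sum fun i _ => ?_
  have h2 : wt w l (n - i) g ξ ≤ A (n - i) := hA _ ⟨ξ, rfl⟩
  have h3 := norm_iteratedFDeriv_char_le x i ξ
  rw [mul_assoc]
  unfold wt at h2
  gcongr

theorem MemSOmega.conjReflTrans {f : E d → ℂ} (hf : MemSOmega w f) (x : E d) :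
    MemSOmega w (conjReflTrans x f) := by
  refine ⟨?_, hf.decays.conjReflTrans x, ?_⟩
  · exact Complex.conjLIE.integrable_comp_iff.2 (hf.integrable.comp_sub_left x)
  · have h1 : Decays w (fun ξ : E d => conj (fourier f ξ)) := by
      refine ⟨Complex.conjCLE.contDiff.comp hf.decays_fourier.smooth, fun l hl n => ?_⟩
      have e : wt w l n (fun ξ : E d => conj (fourier f ξ)) = wt w l n (fourier f) := by
        ext ξ
        unfold wt
        congr 1
        exact Complex.conjLIE.norm_iteratedFDeriv_comp_left (fourier f) ξ n
      rw [e]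
      exact hf.decays_fourier.bdd l hl n
    rw [show fourier (OmegaConv.conjReflTrans x f) = _ from
      funext (fourier_conjReflTrans x f)]
    exact h1.char_mul x

end translation

/-- The convolution `(a ∗ f)(x) = ⟨a, conj f(x - ·)⟩`, that is `∫ a(y) f(x - y) dy` if `a` is
a function. -/
def conv {d : ℕ} {w : Weight} (a : DualSOmega d w) (f : SOmega d w) (x : E d) : ℂ :=
  a (SOmega.mk (conjReflTrans x f.val) (f.mem.conjReflTrans x))

/-- `a ∈ S'_w(ℝ^d)` is a `w`-convolutor if `a ∗ f ∈ S_w(ℝ^d)` for every `f ∈ S_w(ℝ^d)`. -/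
def IsConvolutor {d : ℕ} {w : Weight} (a : DualSOmega d w) : Prop :=
  ∀ f : SOmega d w, MemSOmega w (conv a f)

/-- The convolution operator `C_a : S_w(ℝ^d) → S_w(ℝ^d)`, `C_a f = a ∗ f`. -/
def convOp {d : ℕ} {w : Weight} (a : DualSOmega d w) (ha : IsConvolutor a) :
    SOmega d w →ₗ[ℂ] SOmega d w where
  toFun f := SOmega.mk (conv a f) (ha f)
  map_add' f g := by
    ext x
    simp only [SOmega.val_mk, SOmega.val_add, Pi.add_apply, conv, ← map_add]
    congr 1
    ext y
    simp [conjReflTrans]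
  map_smul' c f := by
    ext x
    simp only [SOmega.val_mk, SOmega.val_smul, Pi.smul_apply, conv, RingHom.id_apply]
    rw [← Complex.conj_conj c, smul_eq_mul, ← smul_eq_mul, ← map_smulₛₗ, Complex.conj_conj]
    congr 1
    ext y
    simp [conjReflTrans]

end OmegaConv

end

noncomputable section

namespace OmegaConv

open MeasureTheory Filter Topology Set
open scoped ContDiff ComplexConjugate

variable {d : ℕ} {w : Weight}

/-! Compactness enters only through boundedness: some 0-neighbourhood has a bounded image, so a
single continuous seminorm `p` dominates every seminorm `q` of `T f`, that is, `q (T f) ≤ B_q * p f`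
(`exists_bound_of_isCompactOperator`). Convolution commutes with translations, and translating `f`
by `h` tests this inequality at infinity. The right side grows at most like `e^{c w(h)}`, with `c`
fixed once `p` and `f` are (`sup_seminormFamily_translate_le`). On the left, `q` may afterwards be
chosen with a weight `e^{l w}` for `l` large compared with `c`; at the point `y + h`, where the
translate of `T f` takes the value `T f (y)`, it grows faster than `e^{c w(h)}` unless `T f (y) =
0`. Since `w` tends to infinity, `T = 0`, and an `a` whose convolution operator vanishes is zero. -/

/-! ### Growth of the weight -/

theorem Weight.exists_log_le (w : Weight) :
    ∃ C : ℝ, 0 ≤ C ∧ ∃ R : ℝ, 1 ≤ R ∧ ∀ t, R ≤ t → Real.log t ≤ C * w t := by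
  obtain ⟨C, hC, h⟩ := w.gamma.exists_nonneg
  obtain ⟨R, hR⟩ := eventually_atTop.1 h.bound
  refine ⟨C, hC, max R 1, le_max_right _ _, fun t ht => ?_⟩
  have h1 := hR t ((le_max_left _ _).trans ht)
  have h0 : 0 ≤ t := zero_le_one.trans ((le_max_right _ _).trans ht)
  rw [Real.norm_eq_abs, Real.norm_eq_abs, abs_of_nonneg (w.nonneg t h0)] at h1
  exact (le_abs_self _).trans h1

/-- By `(γ)`, powers of `‖h‖` produced by differentiating characters are absorbed into the
exponential weight. -/
theorem Weight.exists_pow_le_exp (w : Weight) (n : ℕ) :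
    ∃ c : ℝ, 0 ≤ c ∧ ∃ R : ℝ, 1 ≤ R ∧ ∀ t, R ≤ t → t ^ n ≤ Real.exp (c * w t) := by
  obtain ⟨C, hC, R, hR, h⟩ := w.exists_log_le
  refine ⟨n * C, by positivity, R, hR, fun t ht => ?_⟩
  have h0 : 0 < t := zero_lt_one.trans_le (hR.trans ht)
  rw [← Real.exp_log (pow_pos h0 n), Real.log_pow, mul_assoc]
  gcongr
  exact h t ht

theorem Weight.tendsto_atTop (w : Weight) : Tendsto w atTop atTop := by
  obtain ⟨C, hC, R, hR, h⟩ := w.exists_log_le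
  have hC1 : 0 < C + 1 := by positivity
  refine (tendsto_const_mul_atTop_of_pos hC1).1 (tendsto_atTop_mono' _ ?_ Real.tendsto_log_atTop)
  filter_upwards [eventually_ge_atTop R] with t ht
  have h1 := w.nonneg t (by linarith)
  have h2 := h t ht
  linarith

/-! ### Growth of seminorms under translation -/

namespace SOmega

/-- The translate `y ↦ f (y - h)`. -/
def translate (h : E d) (f : SOmega d w) : SOmega d w :=
  -- Two conjugate reflections compose to a translation, so membership comes for free.
  mk (conjReflTrans h (conjReflTrans 0 f.val)) ((f.mem.conjReflTrans 0).conjReflTrans h)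

@[simp] theorem val_translate (h : E d) (f : SOmega d w) (y : E d) :
    (translate h f).val y = f.val (y - h) := by
  simp [translate, conjReflTrans]

theorem wt_le_seminorm (l : {l : ℝ // 0 < l}) (n : ℕ) (f : SOmega d w) (x : E d) :
    wt w l n f.val x ≤ seminorm l n f :=
  le_ciSup (f.mem.decays.bdd l l.2 n) x

/-- The substitute for subadditivity splits `w ‖x‖` into a part at `x - h`, absorbed by a seminorm
of `f` with the larger exponent `l * L`, and a part at `h`. -/
theorem seminorm_translate_le (l : {l : ℝ // 0 < l}) (n : ℕ) (f : SOmega d w) :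
    ∃ C c : ℝ, 0 ≤ C ∧ 0 ≤ c ∧ ∀ h : E d,
      seminorm l n (translate h f) ≤ C * Real.exp (c * w ‖h‖) := by
  obtain ⟨L, hL, hsub⟩ := w.exists_add_le
  have hl := l.2
  have hlL : 0 < l.1 * L := by positivity
  have hA : 0 ≤ seminorm ⟨l.1 * L, hlL⟩ n f := apply_nonneg _ _
  refine ⟨seminorm ⟨l.1 * L, hlL⟩ n f * Real.exp (l.1 * L), l.1 * L, by positivity, hlL.le,
    fun h => ciSup_le fun x => ?_⟩
  have h1 : w ‖x‖ ≤ L * w ‖x - h‖ + L * w ‖h‖ + L := by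
    refine le_trans (w.monotoneOn (mem_Ici.2 (norm_nonneg _)) (mem_Ici.2 (by positivity)) ?_)
      (hsub ‖x - h‖ ‖h‖ (norm_nonneg _) (norm_nonneg _))
    simpa using norm_add_le (x - h) h
  have h2 := wt_le_seminorm ⟨l.1 * L, hlL⟩ n f (x - h)
  have e : ‖iteratedFDeriv ℝ n (translate h f).val x‖ = ‖iteratedFDeriv ℝ n f.val (x - h)‖ := by
    rw [translate, val_mk, norm_iteratedFDeriv_conjReflTrans, norm_iteratedFDeriv_conjReflTrans,
      zero_sub, neg_sub]
  unfold wt at h2 ⊢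
  rw [e]
  calc _ ≤ ‖iteratedFDeriv ℝ n f.val (x - h)‖ * (Real.exp (l.1 * L * w ‖x - h‖) *
        (Real.exp (l.1 * L) * Real.exp (l.1 * L * w ‖h‖))) := by
        rw [← Real.exp_add, ← Real.exp_add]
        gcongr
        nlinarith
    _ = (‖iteratedFDeriv ℝ n f.val (x - h)‖ * Real.exp (l.1 * L * w ‖x - h‖)) *
        Real.exp (l.1 * L) * Real.exp (l.1 * L * w ‖h‖) := by ring
    _ ≤ _ := by gcongr

theorem fourier_translate (h : E d) (f : SOmega d w) :
    fourier (translate h f).val =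
      fun ξ => Complex.exp (-(Complex.I * (inner ℝ h ξ : ℝ))) * fourier f.val ξ := by
  ext ξ
  rw [translate, val_mk, fourier_conjReflTrans, fourier_conjReflTrans]
  simp

/-- On the Fourier side translation is multiplication by a character, whose `i`-th derivative is at
most `‖h‖ ^ i`. For large `‖h‖` this is below `‖h‖ ^ n`, hence below an exponential of the weight.
-/
theorem seminormFourier_translate_le (l : {l : ℝ // 0 < l}) (n : ℕ) (f : SOmega d w) :
    ∃ C c R : ℝ, 0 ≤ C ∧ 0 ≤ c ∧ ∀ h : E d, R ≤ ‖h‖ →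
      seminormFourier l n (translate h f) ≤ C * Real.exp (c * w ‖h‖) := by
  obtain ⟨c, hc, R, hR, hpow⟩ := w.exists_pow_le_exp n
  refine ⟨∑ i ∈ Finset.range (n + 1), (n.choose i : ℝ) * seminormFourier l (n - i) f, c, R,
    Finset.sum_nonneg fun i _ => mul_nonneg (by positivity) (apply_nonneg _ _), hc,
    fun h hh => ciSup_le fun ξ => ?_⟩
  rw [fourier_translate]
  unfold wt
  refine (mul_le_mul_of_nonneg_right (norm_iteratedFDeriv_mul_le (contDiff_char h)
    f.mem.decays_fourier.smooth ξ (n := n) (mod_cast le_top)) (Real.exp_nonneg _)).trans ?_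
  rw [Finset.sum_mul, Finset.sum_mul]
  refine Finset.sum_le_sum fun i hi => ?_
  have h2 : wt w l (n - i) (fourier f.val) ξ ≤ seminormFourier l (n - i) f :=
    le_ciSup (f.mem.decays_fourier.bdd l l.2 (n - i)) ξ
  have h3 : ‖iteratedFDeriv ℝ i
      (fun ξ : E d => Complex.exp (-(Complex.I * (inner ℝ h ξ : ℝ)))) ξ‖
      ≤ Real.exp (c * w ‖h‖) :=
    (norm_iteratedFDeriv_char_le h i ξ).trans <|
      (pow_le_pow_right₀ (hR.trans hh) (Nat.lt_succ_iff.1 (Finset.mem_range.1 hi))).trans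
        (hpow _ hh)
  unfold wt at h2
  calc _ = (n.choose i : ℝ) * (‖iteratedFDeriv ℝ (n - i) (fourier f.val) ξ‖ *
        Real.exp (l * w ‖ξ‖)) * ‖iteratedFDeriv ℝ i
        (fun ξ : E d => Complex.exp (-(Complex.I * (inner ℝ h ξ : ℝ)))) ξ‖ := by ring
    _ ≤ _ := by
      have := apply_nonneg (seminormFourier (d := d) (w := w) l (n - i)) f
      gcongr

/-- Every continuous seminorm of a translate grows at most like `e^{c w(h)}`. -/
theorem sup_seminormFamily_translate_le
    (s : Finset (({l : ℝ // 0 < l} × ℕ) ⊕ ({l : ℝ // 0 < l} × ℕ))) (f : SOmega d w) :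
    ∃ C c R : ℝ, 0 < C ∧ 0 ≤ c ∧ ∀ h : E d, R ≤ ‖h‖ →
      s.sup (seminormFamily d w) (translate h f) ≤ C * Real.exp (c * w ‖h‖) := by
  classical
  have single : ∀ i, ∃ C c R : ℝ, 0 ≤ C ∧ 0 ≤ c ∧ ∀ h : E d, R ≤ ‖h‖ →
      seminormFamily d w i (translate h f) ≤ C * Real.exp (c * w ‖h‖) := by
    rintro (⟨l, n⟩ | ⟨l, n⟩)
    · obtain ⟨C, c, hC, hc, h⟩ := seminorm_translate_le l n f
      exact ⟨C, c, 0, hC, hc, fun x _ => h x⟩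
    · exact seminormFourier_translate_le l n f
  induction s using Finset.induction_on with
  | empty =>
    -- The empty supremum is zero, but `C` is kept positive so that the bound can later serve as `M
    -- > 0`.
    refine ⟨1, 0, 0, one_pos, le_rfl, fun h _ => ?_⟩
    simp
  | insert i s _ ih =>
    obtain ⟨C, c, R, hC, hc, hs⟩ := ih
    obtain ⟨C', c', R', hC', hc', hi⟩ := single i
    refine ⟨C + C', c + c', max R R', by positivity, by positivity, fun h hh => ?_⟩
    have hw := w.nonneg ‖h‖ (norm_nonneg _)
    rw [Finset.sup_insert]
    refine sup_le ((hi h ((le_max_right _ _).trans hh)).trans ?_)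
      ((hs h ((le_max_left _ _).trans hh)).trans ?_)
    · gcongr <;> linarith
    · gcongr <;> linarith

/-! ### Compact operators commuting with translations -/

/-- A compact operator into `S_w` is bounded, in every seminorm, by one continuous seminorm. -/
theorem exists_bound_of_isCompactOperator {T : SOmega d w →ₗ[ℂ] SOmega d w}
    (hT : IsCompactOperator T) :
    ∃ s : Finset (({l : ℝ // 0 < l} × ℕ) ⊕ ({l : ℝ // 0 < l} × ℕ)), ∀ i, ∃ B : ℝ, 0 ≤ B ∧
      ∀ (f : SOmega d w) (M : ℝ), 0 < M → s.sup (seminormFamily d w) f ≤ M →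
        seminormFamily d w i (T f) ≤ B * M := by
  obtain ⟨K, hK, hU⟩ := hT
  obtain ⟨s, r, hr, hball⟩ := ((withSeminorms d w).mem_nhds_iff 0 _).1 hU
  refine ⟨s, fun i => ?_⟩
  obtain ⟨B, hB⟩ := hK.bddAbove_image
    ((withSeminorms d w).continuous_seminorm i).continuousOn
  refine ⟨max B 0 * (2 / r), by positivity, fun f M hM hf => ?_⟩
  -- Scaling by an upper bound `M > 0` avoids dividing by a seminorm that may vanish; the factor 2
  -- gives the strict inequality of the open ball.
  have hmem : ((r / (2 * M) : ℝ) : ℂ) • f ∈ (s.sup (seminormFamily d w)).ball 0 r := by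
    rw [Seminorm.mem_ball_zero, map_smul_eq_mul, Complex.norm_real, Real.norm_eq_abs,
      abs_of_pos (by positivity)]
    calc _ ≤ r / (2 * M) * M := by gcongr
      _ = r / 2 := by field_simp
      _ < r := half_lt_self hr
  have h1 : seminormFamily d w i (T (((r / (2 * M) : ℝ) : ℂ) • f)) ≤ B :=
    hB ⟨_, hball hmem, rfl⟩
  rw [map_smul, map_smul_eq_mul, Complex.norm_real, Real.norm_eq_abs,
    abs_of_pos (by positivity)] at h1
  have h2 := h1.trans (le_max_left B 0)
  rw [div_mul_eq_mul_div, div_le_iff₀ (by positivity)] at h2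
  rw [mul_div_assoc', div_mul_eq_mul_div, le_div_iff₀ hr]
  linarith

/-- A compact operator on `S_w(ℝ^d)`, `d ≥ 1`, that commutes with translations vanishes. -/
theorem eq_zero_of_isCompactOperator (hd : 1 ≤ d) {T : SOmega d w →ₗ[ℂ] SOmega d w}
    (hT : IsCompactOperator T) (hcomm : ∀ h f, T (translate h f) = translate h (T f)) :
    T = 0 := by
  ext f y
  by_contra hy
  replace hy : 0 < ‖(T f).val y‖ := norm_pos_iff.2 hy
  obtain ⟨s, hs⟩ := exists_bound_of_isCompactOperator hT
  obtain ⟨C, c, R, hC, hc, hf⟩ := sup_seminormFamily_translate_le s f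
  obtain ⟨L, hL, hsub⟩ := w.exists_add_le
  -- The exponent is chosen after `c`: the factor `L` pays for the loss in comparing `w ‖h‖` with `w
  -- ‖y + h‖`, and the surplus 1 leaves the unbounded factor `e^{w(h)}`.
  have hl : 0 < L * (c + 1) := by positivity
  obtain ⟨B, hB, hTB⟩ := hs (Sum.inl (⟨L * (c + 1), hl⟩, 0))
  -- `D` collects the terms independent of `h` in `(c + 1) * w ‖h‖ ≤ L * (c + 1) * w ‖y + h‖ + D`.
  set D : ℝ := (c + 1) * (L * w ‖y‖ + L)
  have key : ∀ h : E d, R ≤ ‖h‖ →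
      ‖(T f).val y‖ * Real.exp (w ‖h‖) ≤ B * C * Real.exp D := by
    intro h hh
    have h1 := hTB (translate h f) (C * Real.exp (c * w ‖h‖)) (by positivity) (hf h hh)
    have h2 := (wt_le_seminorm ⟨L * (c + 1), hl⟩ 0 (T (translate h f)) (y + h)).trans h1
    rw [wt, norm_iteratedFDeriv_zero, hcomm, val_translate, add_sub_cancel_right] at h2
    have h3 : w ‖h‖ ≤ L * w ‖y + h‖ + L * w ‖y‖ + L := by
      refine le_trans (w.monotoneOn (mem_Ici.2 (norm_nonneg _)) (mem_Ici.2 (by positivity)) ?_)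
        (hsub ‖y + h‖ ‖y‖ (norm_nonneg _) (norm_nonneg _))
      simpa using norm_sub_le (y + h) y
    have h4 : w ‖h‖ ≤ L * (c + 1) * w ‖y + h‖ + (D - c * w ‖h‖) := by
      simp only [D]
      nlinarith
    calc ‖(T f).val y‖ * Real.exp (w ‖h‖)
        ≤ ‖(T f).val y‖ *
          (Real.exp (L * (c + 1) * w ‖y + h‖) * Real.exp (D - c * w ‖h‖)) := by
          rw [← Real.exp_add]
          gcongr
      _ = ‖(T f).val y‖ * Real.exp (L * (c + 1) * w ‖y + h‖) * Real.exp (D - c * w ‖h‖) := by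
          ring
      _ ≤ B * (C * Real.exp (c * w ‖h‖)) * Real.exp (D - c * w ‖h‖) := by gcongr
      _ = B * C * Real.exp D := by
          rw [Real.exp_sub]
          field_simp
  have htend : Tendsto (fun t => ‖(T f).val y‖ * Real.exp (w t)) atTop atTop :=
    (Real.tendsto_exp_atTop.comp w.tendsto_atTop).const_mul_atTop hy
  obtain ⟨t, ht, ht0, htR⟩ := ((htend.eventually_gt_atTop (B * C * Real.exp D)).and
    ((eventually_ge_atTop 0).and (eventually_ge_atTop R))).exists
  -- `d ≥ 1` provides vectors of arbitrarily large norm.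
  have hn : ‖EuclideanSpace.single (⟨0, hd⟩ : Fin d) t‖ = t := by
    rw [PiLp.norm_single, Real.norm_eq_abs, abs_of_nonneg ht0]
  have h5 := key (EuclideanSpace.single ⟨0, hd⟩ t) (by rwa [hn])
  rw [hn] at h5
  exact absurd h5 (not_le.2 ht)

end SOmega

/-! ### Back to convolution operators -/

theorem convOp_translate (a : DualSOmega d w) (ha : IsConvolutor a) (h : E d) (f : SOmega d w) :
    convOp a ha (SOmega.translate h f) = SOmega.translate h (convOp a ha f) := by
  ext x
  rw [SOmega.val_translate]
  simp only [convOp, LinearMap.coe_mk, AddHom.coe_mk, SOmega.val_mk, conv]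
  congr 1
  ext y
  simp [conjReflTrans, sub_right_comm]

/-- Conjugate reflection at 0 is an involution, so `⟨a, f⟩` is the value at 0 of the convolution of
`a` with the conjugate reflection of `f`. -/
theorem eq_zero_of_convOp_eq_zero {a : DualSOmega d w} {ha : IsConvolutor a}
    (h : convOp a ha = 0) : a = 0 := by
  ext f
  have h1 := congrArg (fun T => (T (SOmega.mk _ (f.mem.conjReflTrans 0))).val 0) h
  simp only [convOp, LinearMap.coe_mk, AddHom.coe_mk, SOmega.val_mk, conv] at h1
  have e : SOmega.mk _ ((f.mem.conjReflTrans 0).conjReflTrans 0) = f := by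
    ext y
    simp [conjReflTrans]
  simp only [e] at h1
  exact h1

theorem convOp_zero (ha : IsConvolutor (0 : DualSOmega d w)) : convOp 0 ha = 0 := by
  ext f x
  rfl

end OmegaConv

end

theorem mainTheorem7 (d : ℕ) (hd : 1 ≤ d) (w : OmegaConv.Weight)
    (a : OmegaConv.DualSOmega d w) (ha : OmegaConv.IsConvolutor a) :
    IsCompactOperator (OmegaConv.convOp a ha) ↔ a = 0 := by
  constructor
  · intro h
    exact OmegaConv.eq_zero_of_convOp_eq_zero
      (OmegaConv.SOmega.eq_zero_of_isCompactOperator hd h (OmegaConv.convOp_translate a ha))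
  · rintro rfl
    rw [OmegaConv.convOp_zero]
    exact isCompactOperator_zero
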